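/- **Setting.** Fix $V,T>0$; let $\mathbb T=\mathbb R/\mathbb Z$ with Lebesgue measure $\mathcal L_{\mathbb T}$, $\Omega_V=\mathbb T\times\{-V,V\}$, $\iota(x,v)=(x,-v)$ and $\pi=\mathcal L_{\mathbb T}\otimes\mathrm{Unif}_{\{-V,V\}}$. Let $\mathcal P$ and $\mathcal M$ denote Borel probability measures and finite signed Borel measures, with the narrow topology (duality with bounded continuous functions). *Continuity equation.* $(\sigma,j)\in\mathrm{CE}(0,T;\Omega_V)$ if $\sigma\in C([0,T];\mathcal P(\Omega_V))$, $(j_t)_{t\in(0,T)}=(j^1_t,j^2_t)_{t\in(0,T)}$ is a measurable family in $\mathcal M(\Omega_V;\mathbb R^2)$ with $\int_0^T\|j_t\|_{TV}\,dt<\infty$, and for all $\varphi$ on $\Omega_V$ that are $C^1$ in $x$ and all $0\le s\le t\le T$, $$\int\varphi\,d\sigma_t-\int\varphi\,d\sigma_s=\int_s^t\Big(\int\partial_x\varphi\,dj^1_r+\int(\varphi\circ\iota-\varphi)\,dj^2_r\Big)dr .$$ *Rate functional.* For $\lambda>0$, $\mathscr I^\lambda(\sigma,j)=\int_0^T\mathscr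 L^\lambda(\sigma_t,j_t)\,dt$ if $(\sigma,j)\in\mathrm{CE}(0,T;\Omega_V)$ and $+\infty$ otherwise, where $$\mathscr L^\lambda(\sigma,j)=\sup_{\varphi_1,\varphi_2\in C(\Omega_V)}\Big\{\int\varphi_1\,dj^1+\int\varphi_2\,dj^2-\int\big[v\varphi_1+\lambda(e^{\varphi_2}-1)\big]\,d\sigma\Big\}$$ (equivalently, the relative entropy $\mathrm{Ent}(j^2|\lambda\sigma)$ if $j^1=v\sigma$ and $+\infty$ otherwise). *Momentum system.* $(\rho,\omega,K)\in\mathrm{ME}(0,T;\mathbb T)$ if $\rho\in C([0,T];\mathcal P(\mathbb T))$, $\omega\in C((0,T);\mathcal M(\mathbb T))$, $(K_t)_{t\in(0,T)}\subset\mathcal M(\mathbb T)$ is a measurable family with $\int_0^T\|K_t\|_{TV}\,dt<\infty$, and for all $\varphi,\psi\in C^1(\mathbb T)$ and $0\le s\le t\le T$, $$\int\varphi\,d\rho_t-\int\varphi\,d\rho_s=\int_s^t\!\int\partial_x\varphi\,d\omega_r\,dr,\qquad \int\psi\,d\omega_t-\int\psi\,d\omega_s=V^2\!\int_s^t\!\int\partial_x\psi\,d\rho_r\,dr-2\int_s^t\!\int\psi\,dK_r\,dr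 .$$ *Limit functional.* For $\rho\in C([0,T];\mathcal P(\mathbb T))$, $\omega\in C([0,T];\mathcal M(\mathbb T))$ and a measurable family $J$ in $\mathcal M(\mathbb T)$, set $\bar{\mathscr J}(\rho,\omega,J)=0$ if $(\rho,\omega,J)\in\mathrm{ME}(0,T;\mathbb T)$ and $J_t=0$ for a.e. $t\in(0,T)$, and $\bar{\mathscr J}(\rho,\omega,J)=+\infty$ otherwise. **Theorem 4.11 (liminf inequality, hyperbolic limit).** Let $\lambda\to0$, $\lambda>0$ (along a sequence, or any index set with a countably generated filter), let $(\sigma^\lambda,j^\lambda)\in\mathrm{CE}(0,T;\Omega_V)$ and let $C<\infty$ be such that for all $\lambda$ $$\mathrm{Ent}(\sigma^\lambda_0\mid\pi)+\mathscr I^\lambda(\sigma^\lambda,j^\lambda)\le C .$$ Put $\rho^\lambda_t(dx)=\sum_v\sigma^\lambda_t(dx,v)$, $\omega^\lambda_t(dx)=\sum_v v\,\sigma^\lambda_t(dx,v)$, $J^\lambda_t(dx)=\sum_v v\,j^{2,\lambda}_t(dx,v)$. Assume that $\rho^\lambda_t\to\bar\rho_t$ narrowly in $\mathcal P(\mathbb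 T)$ for every $t\in[0,T]$ (hence also $\rho^\lambda_t(dx)\,dt\to\bar\rho_t(dx)\,dt$ narrowly on $(0,T)\times\mathbb T$), and that $\omega^\lambda_t(dx)\,dt\to\bar\omega$ and $J^\lambda_t(dx)\,dt\to\bar J$ narrowly in $\mathcal M((0,T)\times\mathbb T)$. Then $\bar\omega(dt\,dx)=\bar\omega_t(dx)\,dt$ and $\bar J(dt\,dx)=\bar J_t(dx)\,dt$ for some families $(\bar\omega_t)_{t\in[0,T]}\in C([0,T];\mathcal M(\mathbb T))$ and $(\bar J_t)_{t\in(0,T)}$, such that $$\liminf_{\lambda\to0}\mathscr I^\lambda(\sigma^\lambda,j^\lambda)\ \ge\ \bar{\mathscr J}(\bar\rho,\bar\omega,\bar J).$$ Moreover $\bar J=0$ and $(\bar\rho,\bar\omega,0)\in\mathrm{ME}(0,T;\mathbb T)$, i.e. $(\bar\rho,\bar\omega)$ is a weak solution of the wave system $\partial_t\rho=-\partial_x\omega$, $\partial_t\omega=-V^2\partial_x\rho$. -/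

import Mathlib

open MeasureTheory Filter Topology Set
open scoped ENNReal NNReal BoundedContinuousFunction

noncomputable section

namespace Kac

/-- The one-dimensional torus `𝕋 = ℝ / ℤ`; its `volume` is Lebesgue measure, of total mass `1`. -/
abbrev Torus := UnitAddCircle

/-- The two admissible velocities `{-V, V}`. -/
abbrev Velocity (V : ℝ) := ({-V, V} : Set ℝ)

/-- The phase space `Ω_V = 𝕋 × {-V, V}`. -/
abbrev Phase (V : ℝ) := Torus × Velocity V

/-- The velocity `V`. -/
def velPlus (V : ℝ) : Velocity V := ⟨V, by simp⟩

/-- The velocity `-V`. -/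
def velMinus (V : ℝ) : Velocity V := ⟨-V, by simp⟩

/-- The velocity reversal `ι (x, v) = (x, -v)`. -/
def reversal (V : ℝ) (p : Phase V) : Phase V :=
  (p.1, ⟨-(p.2 : ℝ), by
    rcases p.2.2 with h | h
    · right; simp [h]
    · left; rw [h]⟩)

/-- The stationary measure `π = Lebesgue ⊗ Unif {-V, V}`. -/
def stationary (V : ℝ) : Measure (Phase V) :=
  (volume : Measure Torus).prod
    ((2⁻¹ : ℝ≥0∞) • (Measure.dirac (velMinus V) + Measure.dirac (velPlus V)))

/-- `φ` is of class `C¹` on the torus, with derivative `φ'`. -/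
def HasTorusDeriv (φ φ' : C(Torus, ℝ)) : Prop :=
  ∀ x : Torus, HasDerivAt (fun s : ℝ => φ (x + (s : Torus))) (φ' x) 0

/-- `φ` is of class `C^{1,0}` on `Ω_V`, with `x`-derivative `φ'`. -/
def HasPhaseDeriv (V : ℝ) (φ φ' : C(Phase V, ℝ)) : Prop :=
  ∀ (x : Torus) (v : Velocity V),
    HasDerivAt (fun s : ℝ => φ (x + (s : Torus), v)) (φ' (x, v)) 0

/-- Lebesgue measure on the open time interval `(0,T)`. -/
def timeMeasure (T : ℝ) : Measure (Ioo (0 : ℝ) T) :=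
  volume.comap Subtype.val

/-- `(m_t)`, `t ∈ (0,T)`, is a measurable family of finite signed measures with
`∫₀ᵀ ‖m_t‖_TV dt < ∞`. -/
def IntegrableFamily {X : Type*} [MeasurableSpace X] (T : ℝ) (m : ℝ → SignedMeasure X) : Prop :=
  (∀ A : Set X, MeasurableSet A → Measurable (fun t : Ioo (0 : ℝ) T => m t A)) ∧
    ∫⁻ t in Ioo (0 : ℝ) T, (m t).totalVariation univ < ∞

/-- Continuity of a curve of signed measures on the torus for the narrow topology. -/
def NarrowContinuousOn (m : ℝ → SignedMeasure Torus) (I : Set ℝ) : Prop :=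
  ∀ f : C(Torus, ℝ), ContinuousOn (fun t => ∫ᵛ x, f x ∂•(m t)) I

/-- The continuity equation `∂ₜ σ + div j = 0` on `Ω_V`, `j = (j¹, j²)`, tested against
`(∂ₓ φ, φ ∘ ι - φ)`. -/
structure ContinuityEq (V T : ℝ) (σ : ℝ → ProbabilityMeasure (Phase V))
    (j₁ j₂ : ℝ → SignedMeasure (Phase V)) : Prop where
  continuousOn : ContinuousOn σ (Icc 0 T)
  integrable₁ : IntegrableFamily T j₁
  integrable₂ : IntegrableFamily T j₂
  weak : ∀ φ φ' : C(Phase V, ℝ), HasPhaseDeriv V φ φ' →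
    ∀ s t : ℝ, 0 ≤ s → s ≤ t → t ≤ T →
      ∫ p, φ p ∂(σ t : Measure (Phase V)) - ∫ p, φ p ∂(σ s : Measure (Phase V)) =
        ∫ r in s..t, (∫ᵛ p, φ' p ∂•(j₁ r) + ∫ᵛ p, (φ (reversal V p) - φ p) ∂•(j₂ r))

/-- The Hamiltonian `ℋ(σ, φ) = ∫ (v φ₁ + λ (exp φ₂ - 1)) dσ`. -/
def hamiltonian (V lam : ℝ) (σ : Measure (Phase V)) (φ : C(Phase V, ℝ) × C(Phase V, ℝ)) : ℝ :=
  ∫ p, ((p.2 : ℝ) * φ.1 p + lam * (Real.exp (φ.2 p) - 1)) ∂σ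

/-- The Lagrangian `ℒ(σ, j) = sup_φ (⟨φ, j⟩ - ℋ(σ, φ)) ∈ [0, ∞]`. The supremum is nonnegative
(take `φ = 0`), so truncating each term at `0` does not change it. -/
def lagrangian (V lam : ℝ) (σ : Measure (Phase V)) (j₁ j₂ : SignedMeasure (Phase V)) : ℝ≥0∞ :=
  ⨆ φ : C(Phase V, ℝ) × C(Phase V, ℝ),
    ENNReal.ofReal (∫ᵛ p, φ.1 p ∂•j₁ + ∫ᵛ p, φ.2 p ∂•j₂ - hamiltonian V lam σ φ)

open Classical in
/-- The rate functional `ℐ^λ(σ, j)`. -/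
def rate (V T lam : ℝ) (σ : ℝ → ProbabilityMeasure (Phase V))
    (j₁ j₂ : ℝ → SignedMeasure (Phase V)) : ℝ≥0∞ :=
  if ContinuityEq V T σ j₁ j₂ then
    ∫⁻ t in Ioo (0 : ℝ) T, lagrangian V lam (σ t : Measure (Phase V)) (j₁ t) (j₂ t)
  else ∞

/-- The slice `j(dx, v)` at a fixed velocity `v`. -/
def slice {V : ℝ} (j : SignedMeasure (Phase V)) (v : Velocity V) : SignedMeasure Torus :=
  (j.restrict (univ ×ˢ {v})).map Prod.fst

/-- The first velocity moment `∑_v v j(dx, v)`. -/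
def firstMoment {V : ℝ} (j : SignedMeasure (Phase V)) : SignedMeasure Torus :=
  ∑ v : Velocity V, (v : ℝ) • slice j v

/-- The density `ρ(dx) = ∑_v σ(dx, v)`, the marginal of `σ` on the torus. -/
def density {V : ℝ} (σ : ProbabilityMeasure (Phase V)) : ProbabilityMeasure Torus :=
  σ.map measurable_fst.aemeasurable

/-- The flux `ω(dx) = ∑_v v σ(dx, v)`. -/
def flux {V : ℝ} (σ : ProbabilityMeasure (Phase V)) : SignedMeasure Torus :=
  firstMoment (σ : Measure (Phase V)).toSignedMeasure

/-- The momentum equation `∂ₜ ρ + ∂ₓ ω = 0`, `∂ₜ ω + V² ∂ₓ ρ = -2 K` in the weak sense. -/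
structure MomentumEq (V T : ℝ) (ρ : ℝ → ProbabilityMeasure Torus)
    (ω K : ℝ → SignedMeasure Torus) : Prop where
  continuousOn_density : ContinuousOn ρ (Icc 0 T)
  continuousOn_flux : NarrowContinuousOn ω (Ioo 0 T)
  integrable : IntegrableFamily T K
  weak_density : ∀ φ φ' : C(Torus, ℝ), HasTorusDeriv φ φ' →
    ∀ s t : ℝ, 0 ≤ s → s ≤ t → t ≤ T →
      ∫ x, φ x ∂(ρ t : Measure Torus) - ∫ x, φ x ∂(ρ s : Measure Torus) =
        ∫ r in s..t, ∫ᵛ x, φ' x ∂•(ω r)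
  weak_flux : ∀ ψ ψ' : C(Torus, ℝ), HasTorusDeriv ψ ψ' →
    ∀ s t : ℝ, 0 ≤ s → s ≤ t → t ≤ T →
      ∫ᵛ x, ψ x ∂•(ω t) - ∫ᵛ x, ψ x ∂•(ω s) =
        V ^ 2 * (∫ r in s..t, ∫ x, ψ' x ∂(ρ r : Measure Torus)) -
          2 * ∫ r in s..t, ∫ᵛ x, ψ x ∂•(K r)

open Classical in
/-- The limit functional `𝒥̄(ρ, ω, J)` on curves `ρ ∈ C([0,T]; 𝒫(𝕋))`, `ω ∈ C([0,T]; ℳ(𝕋))` and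
measurable families `J`, where `J = 0` means `J_t = 0` for almost every `t ∈ (0,T)`. -/
def limitFunctional (V T : ℝ) (ρ : ℝ → ProbabilityMeasure Torus)
    (ω J : ℝ → SignedMeasure Torus) : ℝ≥0∞ :=
  if NarrowContinuousOn ω (Icc 0 T) ∧ MomentumEq V T ρ ω J ∧
      ∀ᵐ t ∂(volume.restrict (Ioo (0 : ℝ) T)), J t = 0 then 0
  else ∞

/-- Narrow convergence in `ℳ((0,T) × 𝕋)` of the measures `m^i_t(dx) dt` to `μ` along `l`: both
sides are paired with bounded continuous functions on `(0,T) × 𝕋`. -/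
def SpaceTimeTendsto {ι : Type*} (T : ℝ) (m : ι → ℝ → SignedMeasure Torus) (l : Filter ι)
    (μ : SignedMeasure (Ioo (0 : ℝ) T × Torus)) : Prop :=
  ∀ f : (Ioo (0 : ℝ) T × Torus) →ᵇ ℝ,
    Tendsto (fun i => ∫ t : Ioo (0 : ℝ) T, ∫ᵛ x, f (t, x) ∂•(m i t) ∂(timeMeasure T)) l
      (𝓝 (∫ᵛ z, f z ∂•μ))

/-- The disintegration `μ(dt dx) = m_t(dx) dt` on `(0,T) × 𝕋`. -/
def Disintegrates (T : ℝ) (μ : SignedMeasure (Ioo (0 : ℝ) T × Torus))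
    (m : ℝ → SignedMeasure Torus) : Prop :=
  IntegrableFamily T m ∧
    ∀ A : Set (Ioo (0 : ℝ) T × Torus), MeasurableSet A →
      μ A = ∫ t : Ioo (0 : ℝ) T, m t {x | (t, x) ∈ A} ∂(timeMeasure T)

end Kac

end

namespace MeasureTheory.SignedMeasure

variable {X : Type*} [MeasurableSpace X]

instance isFiniteMeasure_variation (μ : SignedMeasure X) : IsFiniteMeasure μ.variation := by
  rw [← totalVariation_eq_variation, totalVariation]
  infer_instance

theorem integral_toSignedMeasure_real (μ : Measure X) [IsFiniteMeasure μ] (f : X → ℝ) :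
    ∫ᵛ x, f x ∂•μ.toSignedMeasure = ∫ x, f x ∂μ := by
  rw [← VectorMeasure.integral_toSignedMeasure]
  congr 1
  ext
  simp

theorem integrable_of_bound (μ : SignedMeasure X) {f : X → ℝ} (hf : Measurable f) (M : ℝ)
    (hM : ∀ x, |f x| ≤ M) : μ.Integrable f :=
  Integrable.of_bound hf.aestronglyMeasurable M (Eventually.of_forall hM)

theorem integrable_continuousMap [TopologicalSpace X] [CompactSpace X] [OpensMeasurableSpace X]
    (μ : SignedMeasure X) (f : C(X, ℝ)) : μ.Integrable f :=
  μ.integrable_of_bound f.continuous.measurable ‖f‖ f.norm_coe_le_norm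

theorem integrable_boundedContinuous [TopologicalSpace X] [OpensMeasurableSpace X]
    (μ : SignedMeasure X) (f : X →ᵇ ℝ) : μ.Integrable f :=
  μ.integrable_of_bound f.continuous.measurable ‖f‖ f.norm_coe_le_norm

theorem integral_eq_sub_jordan (μ : SignedMeasure X) {f : X → ℝ} (hf : Measurable f) (M : ℝ)
    (hM : ∀ x, |f x| ≤ M) :
    ∫ᵛ x, f x ∂•μ =
      ∫ x, f x ∂μ.toJordanDecomposition.posPart - ∫ x, f x ∂μ.toJordanDecomposition.negPart := by
  conv_lhs => rw [← μ.toSignedMeasure_toJordanDecomposition, JordanDecomposition.toSignedMeasure]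
  rw [VectorMeasure.integral_sub_vectorMeasure (integrable_of_bound _ hf M hM)
    (integrable_of_bound _ hf M hM), integral_toSignedMeasure_real, integral_toSignedMeasure_real]

/-- A signed Borel measure that integrates every bounded continuous function to `0` vanishes. -/
theorem eq_zero_of_forall_integral_eq_zero [TopologicalSpace X] [BorelSpace X]
    [HasOuterApproxClosed X] (μ : SignedMeasure X) (h : ∀ f : X →ᵇ ℝ, ∫ᵛ x, f x ∂•μ = 0) :
    μ = 0 := by
  have : μ.toJordanDecomposition.posPart = μ.toJordanDecomposition.negPart := by
    refine ext_of_forall_integral_eq_of_IsFiniteMeasure fun f => ?_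
    have := h f
    rwa [μ.integral_eq_sub_jordan f.continuous.measurable ‖f‖ f.norm_coe_le_norm,
      sub_eq_zero] at this
  rw [← μ.toSignedMeasure_toJordanDecomposition, JordanDecomposition.toSignedMeasure]
  simp_rw [this, sub_self]

theorem ext_of_forall_integral_eq [TopologicalSpace X] [BorelSpace X] [HasOuterApproxClosed X]
    {μ ν : SignedMeasure X} (h : ∀ f : X →ᵇ ℝ, ∫ᵛ x, f x ∂•μ = ∫ᵛ x, f x ∂•ν) : μ = ν := by
  rw [← sub_eq_zero]
  refine eq_zero_of_forall_integral_eq_zero _ fun f => ?_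
  rw [VectorMeasure.integral_sub_vectorMeasure (integrable_boundedContinuous _ f)
    (integrable_boundedContinuous _ f), h f, sub_self]

theorem integral_const_mul (μ : SignedMeasure X) (c : ℝ) (f : X → ℝ) :
    ∫ᵛ x, c * f x ∂•μ = c * ∫ᵛ x, f x ∂•μ :=
  VectorMeasure.integral_fun_smul μ _ c f

theorem integral_simpleFunc (μ : SignedMeasure X) (f : SimpleFunc X ℝ) :
    ∫ᵛ x, f x ∂•μ = ∑ y ∈ f.range, y * μ (f ⁻¹' {y}) := by
  obtain ⟨M, hM⟩ := f.exists_forall_norm_le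
  rw [μ.integral_eq_sub_jordan f.measurable M hM,
    SimpleFunc.integral_eq_sum f
      (Integrable.of_bound f.aestronglyMeasurable M (Eventually.of_forall hM)),
    SimpleFunc.integral_eq_sum f
      (Integrable.of_bound f.aestronglyMeasurable M (Eventually.of_forall hM)),
    ← Finset.sum_sub_distrib]
  refine Finset.sum_congr rfl fun y _ => ?_
  rw [μ.apply_eq_posPart_real_sub_negPart_real (f.measurableSet_preimage _)]
  simp only [smul_eq_mul]
  ring

/-- Integrals of a bounded measurable function against a measurable family of signed measures
depend measurably on the parameter. -/
theorem measurable_integral {α : Type*} [MeasurableSpace α] {m : α → SignedMeasure X}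
    (hm : ∀ A, MeasurableSet A → Measurable fun a => m a A) {f : X → ℝ} (hf : Measurable f)
    (M : ℝ) (hM : ∀ x, |f x| ≤ M) : Measurable fun a => ∫ᵛ x, f x ∂•(m a) := by
  set F := SimpleFunc.approxOn f hf univ 0 (mem_univ _)
  refine measurable_of_tendsto_metrizable (f := fun n a => ∫ᵛ x, F n x ∂•(m a)) (fun n => ?_) ?_
  · simp_rw [integral_simpleFunc]
    exact Finset.measurable_sum _ fun y _ => (hm _ ((F n).measurableSet_preimage _)).const_mul _
  · rw [tendsto_pi_nhds]
    intro a
    refine VectorMeasure.tendsto_integral_of_dominated_convergence (fun _ => M + M)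
      (fun n => (F n).aestronglyMeasurable) (integrable_const _)
      (fun n => Eventually.of_forall fun x => ?_) (Eventually.of_forall fun x => ?_)
    · refine (SimpleFunc.norm_approxOn_zero_le hf (mem_univ _) x n).trans ?_
      exact add_le_add (hM x) (hM x)
    · exact SimpleFunc.tendsto_approxOn hf (mem_univ _) (by simp)

end MeasureTheory.SignedMeasure

namespace Kac

section Moments

variable {V : ℝ}

theorem integral_slice (j : SignedMeasure (Phase V)) (v : Velocity V) (f : C(Torus, ℝ)) :
    ∫ᵛ x, f x ∂•(slice j v) = ∫ᵛ p in univ ×ˢ {v}, f p.1 ∂•j :=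
  VectorMeasure.integral_map measurable_fst f.continuous.aestronglyMeasurable
    (SignedMeasure.integrable_of_bound _ (f.continuous.measurable.comp measurable_fst) ‖f‖
      fun _ => f.norm_coe_le_norm _)

theorem integral_firstMoment (j : SignedMeasure (Phase V)) (f : C(Torus, ℝ)) :
    ∫ᵛ x, f x ∂•(firstMoment j) = ∫ᵛ p, (p.2 : ℝ) * f p.1 ∂•j := by
  rw [firstMoment, VectorMeasure.integral_finsetSum_vectorMeasure
    (fun v _ => SignedMeasure.integrable_continuousMap _ f)]
  have hcover : (⋃ v : Velocity V, (univ : Set Torus) ×ˢ ({v} : Set (Velocity V))) = univ := by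
    ext p; exact ⟨fun _ => mem_univ _, fun _ => mem_iUnion.2 ⟨p.2, mem_univ _, rfl⟩⟩
  have hmeas (v : Velocity V) : MeasurableSet ((univ : Set Torus) ×ˢ ({v} : Set (Velocity V))) :=
    MeasurableSet.univ.prod (measurableSet_singleton v)
  rw [← VectorMeasure.setIntegral_univ (μ := j), ← hcover,
    VectorMeasure.setIntegral_iUnion_fintype hmeas]
  · refine Finset.sum_congr rfl fun v _ => ?_
    rw [VectorMeasure.integral_smul_vectorMeasure, integral_slice, smul_eq_mul,
      ← SignedMeasure.integral_const_mul]
    refine VectorMeasure.setIntegral_congr_fun fun p hp => ?_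
    simp only [mem_prod, mem_univ, mem_singleton_iff, true_and] at hp
    simp [hp]
  · intro v w hvw
    simp only [Function.onFun, disjoint_left]
    rintro p ⟨-, rfl⟩ ⟨-, h⟩
    exact hvw h
  · intro v
    exact (SignedMeasure.integrable_continuousMap _
      (⟨fun p : Phase V => (p.2 : ℝ) * f p.1, by fun_prop⟩ : C(Phase V, ℝ)))

theorem integral_flux (σ : ProbabilityMeasure (Phase V)) (f : C(Torus, ℝ)) :
    ∫ᵛ x, f x ∂•(flux σ) = ∫ p, (p.2 : ℝ) * f p.1 ∂(σ : Measure (Phase V)) := by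
  rw [flux, integral_firstMoment, SignedMeasure.integral_toSignedMeasure_real]

theorem integral_density (σ : ProbabilityMeasure (Phase V)) (f : C(Torus, ℝ)) :
    ∫ x, f x ∂(density σ : Measure Torus) = ∫ p, f p.1 ∂(σ : Measure (Phase V)) := by
  rw [density, ProbabilityMeasure.toMeasure_map,
    integral_map measurable_fst.aemeasurable f.continuous.aestronglyMeasurable]

end Moments

end Kac

namespace Kac

section TestFunctions

variable {V : ℝ}

theorem HasPhaseDeriv.of_torus {a a' : C(Torus, ℝ)} (h : HasTorusDeriv a a') :
    HasPhaseDeriv V (a.comp ContinuousMap.fst) (a'.comp ContinuousMap.fst) :=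
  fun x _ => h x

/-- The velocity as a continuous function on the phase space. -/
noncomputable def velocityMap (V : ℝ) : C(Phase V, ℝ) := ⟨fun p => (p.2 : ℝ), by fun_prop⟩

@[simp] theorem velocityMap_apply (p : Phase V) : velocityMap V p = (p.2 : ℝ) := rfl

theorem HasPhaseDeriv.velocity_mul {b b' : C(Torus, ℝ)} (h : HasTorusDeriv b b') :
    HasPhaseDeriv V (velocityMap V * b.comp ContinuousMap.fst)
      (velocityMap V * b'.comp ContinuousMap.fst) :=
  fun x v => (h x).const_mul (v : ℝ)

theorem HasPhaseDeriv.velocityMap : HasPhaseDeriv V (velocityMap V) 0 :=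
  fun _ v => hasDerivAt_const _ (v : ℝ)

theorem hasDerivAt_fourier_translate (n : ℤ) (x : Torus) :
    HasDerivAt (fun s : ℝ => (fourier n (x + (s : Torus)) : ℂ))
      (2 * Real.pi * Complex.I * n * fourier n x) 0 := by
  obtain ⟨y, rfl⟩ := QuotientAddGroup.mk_surjective x
  have h := (hasDerivAt_fourier (1 : ℝ) n (y + 0)).comp_const_add y 0
  simpa using h

/-- The algebra of test functions of class `C^{1,0}` on the phase space. -/
noncomputable def smoothPhase (V : ℝ) : Subalgebra ℝ C(Phase V, ℝ) where
  carrier := {φ | ∃ φ', HasPhaseDeriv V φ φ'}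
  mul_mem' := by
    rintro φ ψ ⟨φ', hφ⟩ ⟨ψ', hψ⟩
    exact ⟨φ' * ψ + φ * ψ', fun x v => by
      have h := (hφ x v).mul (hψ x v)
      rw [show φ' (x, v) * ψ (x + ((0 : ℝ) : Torus), v) + φ (x + ((0 : ℝ) : Torus), v) * ψ' (x, v)
        = φ' (x, v) * ψ (x, v) + φ (x, v) * ψ' (x, v) by simp] at h
      exact h⟩
  add_mem' := by
    rintro φ ψ ⟨φ', hφ⟩ ⟨ψ', hψ⟩
    exact ⟨φ' + ψ', fun x v => (hφ x v).add (hψ x v)⟩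
  algebraMap_mem' c := ⟨0, fun _ _ => hasDerivAt_const _ _⟩

theorem smoothPhase_separatesPoints : (smoothPhase V).SeparatesPoints := by
  intro p q hpq
  have hre : HasPhaseDeriv V
      (⟨fun p => (fourier 1 p.1 : ℂ).re, by fun_prop⟩ : C(Phase V, ℝ))
      ⟨fun p => (2 * Real.pi * Complex.I * (1 : ℤ) * fourier 1 p.1 : ℂ).re, by fun_prop⟩ :=
    fun x v => Complex.reCLM.hasFDerivAt.comp_hasDerivAt _ (hasDerivAt_fourier_translate 1 x)
  have him : HasPhaseDeriv V
      (⟨fun p => (fourier 1 p.1 : ℂ).im, by fun_prop⟩ : C(Phase V, ℝ))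
      ⟨fun p => (2 * Real.pi * Complex.I * (1 : ℤ) * fourier 1 p.1 : ℂ).im, by fun_prop⟩ :=
    fun x v => Complex.imCLM.hasFDerivAt.comp_hasDerivAt _ (hasDerivAt_fourier_translate 1 x)
  by_cases hv : (p.2 : ℝ) = q.2
  · have hx : (fourier 1 p.1 : ℂ) ≠ fourier 1 q.1 := by
      rw [fourier_one, fourier_one]
      intro h
      exact hpq (Prod.ext (AddCircle.injective_toCircle one_ne_zero (Subtype.ext h))
        (Subtype.ext hv))
    by_cases h : (fourier 1 p.1 : ℂ).re = (fourier 1 q.1 : ℂ).re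
    · exact ⟨_, ⟨_, ⟨_, him⟩, rfl⟩, fun h' => hx (Complex.ext h h')⟩
    · exact ⟨_, ⟨_, ⟨_, hre⟩, rfl⟩, h⟩
  · exact ⟨_, ⟨_, ⟨_, HasPhaseDeriv.velocityMap⟩, rfl⟩, hv⟩

theorem dense_smoothPhase : Dense (smoothPhase V : Set C(Phase V, ℝ)) := by
  have h := ContinuousMap.subalgebra_topologicalClosure_eq_top_of_separatesPoints _
    (smoothPhase_separatesPoints (V := V))
  rw [dense_iff_closure_eq, ← Subalgebra.topologicalClosure_coe, h, Algebra.coe_top]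

/-- A `C^{1,0}` test function is `a(x) + v b(x)` with `a`, `b` of class `C¹`. -/
theorem HasPhaseDeriv.exists_decomposition (hV : 0 < V) {φ φ' : C(Phase V, ℝ)}
    (h : HasPhaseDeriv V φ φ') :
    ∃ a a' b b' : C(Torus, ℝ), HasTorusDeriv a a' ∧ HasTorusDeriv b b' ∧
      ∀ p, φ p = a p.1 + (p.2 : ℝ) * b p.1 := by
  let r (ψ : C(Phase V, ℝ)) (v : Velocity V) : C(Torus, ℝ) :=
    ψ.comp (ContinuousMap.prodMk (ContinuousMap.id _) (ContinuousMap.const _ v))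
  refine ⟨(2⁻¹ : ℝ) • (r φ (velPlus V) + r φ (velMinus V)),
    (2⁻¹ : ℝ) • (r φ' (velPlus V) + r φ' (velMinus V)),
    ((2 * V)⁻¹ : ℝ) • (r φ (velPlus V) - r φ (velMinus V)),
    ((2 * V)⁻¹ : ℝ) • (r φ' (velPlus V) - r φ' (velMinus V)),
    fun x => ((h x _).add (h x _)).const_mul (2⁻¹ : ℝ),
    fun x => ((h x _).sub (h x _)).const_mul ((2 * V)⁻¹ : ℝ), ?_⟩
  rintro ⟨x, v⟩
  have hv : v = velMinus V ∨ v = velPlus V := by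
    rcases v.2 with hv | hv
    · exact Or.inl (Subtype.ext hv)
    · exact Or.inr (Subtype.ext hv)
  change φ (x, v) = 2⁻¹ * (φ (x, velPlus V) + φ (x, velMinus V)) +
    v * ((2 * V)⁻¹ * (φ (x, velPlus V) - φ (x, velMinus V)))
  rcases hv with rfl | rfl
  · simp only [velMinus]
    field_simp
    ring
  · simp only [velPlus]
    field_simp
    ring

end TestFunctions

section Convergence

variable {V : ℝ}

/-- Narrow convergence on the phase space may be tested on `C^{1,0}` functions. -/
theorem tendsto_of_forall_smoothPhase {β : Type*} {l : Filter β}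
    {σ : β → ProbabilityMeasure (Phase V)} {σ₀ : ProbabilityMeasure (Phase V)}
    (h : ∀ φ ∈ smoothPhase V, Tendsto (fun i => ∫ p, φ p ∂(σ i : Measure (Phase V))) l
      (𝓝 (∫ p, φ p ∂(σ₀ : Measure (Phase V))))) : Tendsto σ l (𝓝 σ₀) := by
  rw [ProbabilityMeasure.tendsto_iff_forall_integral_tendsto]
  intro f
  have hint (g : C(Phase V, ℝ)) (τ : ProbabilityMeasure (Phase V)) :
      Integrable g (τ : Measure (Phase V)) :=
    Integrable.of_bound g.continuous.aestronglyMeasurable ‖g‖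
      (Eventually.of_forall g.norm_coe_le_norm)
  rw [Metric.tendsto_nhds]
  intro ε hε
  obtain ⟨φ, hφ, hφf⟩ := Metric.dense_iff.1 (dense_smoothPhase (V := V)) f.toContinuousMap (ε / 4)
    (by positivity)
  have hclose (τ : ProbabilityMeasure (Phase V)) :
      dist (∫ p, f p ∂(τ : Measure (Phase V))) (∫ p, φ p ∂(τ : Measure (Phase V))) ≤ ε / 4 := by
    have hf : Integrable f (τ : Measure (Phase V)) := hint f.toContinuousMap τ
    rw [dist_eq_norm, ← integral_sub hf (hint φ τ)]
    refine (norm_integral_le_of_norm_le_const (C := ε / 4) (Eventually.of_forall fun p => ?_)).trans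
      (by simp)
    rw [← dist_eq_norm, dist_comm]
    exact (ContinuousMap.dist_apply_le_dist p).trans (Metric.mem_ball.1 hφ).le
  filter_upwards [Metric.tendsto_nhds.1 (h φ hφf) (ε / 4) (by positivity)] with i hi
  have h1 := hclose (σ i)
  have h2 := hclose σ₀
  rw [dist_comm] at h2
  calc _ ≤ _ := dist_triangle4 _ (∫ p, φ p ∂(σ i : Measure (Phase V)))
          (∫ p, φ p ∂(σ₀ : Measure (Phase V))) _
    _ < ε := by linarith

/-- By compactness, convergence of the integrals of all `C^{1,0}` functions produces a narrow
limit. -/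
theorem exists_tendsto_of_forall_smoothPhase {β : Type*} {l : Filter β} [l.NeBot]
    {σ : β → ProbabilityMeasure (Phase V)}
    (h : ∀ φ ∈ smoothPhase V, ∃ c, Tendsto (fun i => ∫ p, φ p ∂(σ i : Measure (Phase V))) l (𝓝 c)) :
    ∃ σ₀, Tendsto σ l (𝓝 σ₀) := by
  obtain ⟨σ₀, -, hσ₀⟩ := isCompact_univ.ultrafilter_le_nhds
    ((Ultrafilter.of l).map σ) (by simp)
  refine ⟨σ₀, tendsto_of_forall_smoothPhase fun φ hφ => ?_⟩
  obtain ⟨c, hc⟩ := h φ hφ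
  have h1 : Tendsto (fun i => ∫ p, φ p ∂(σ i : Measure (Phase V))) (Ultrafilter.of l)
      (𝓝 (∫ p, φ p ∂(σ₀ : Measure (Phase V)))) :=
    ((ProbabilityMeasure.continuous_integral_continuousMap φ).tendsto σ₀).comp hσ₀
  rwa [tendsto_nhds_unique h1 (hc.mono_left (Ultrafilter.of_le l))]

/-- A narrowly continuous curve of probability measures is a measurable family. -/
theorem measurable_toMeasure_of_continuous {α X : Type*} [TopologicalSpace α] [MeasurableSpace α]
    [OpensMeasurableSpace α] [TopologicalSpace X] [MeasurableSpace X] [BorelSpace X]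
    [HasOuterApproxClosed X] {σ : α → ProbabilityMeasure X} (hσ : Continuous σ) :
    Measurable fun a => (σ a : Measure X) := by
  refine Measurable.measure_of_isPiSystem_of_isProbabilityMeasure
    (BorelSpace.measurable_eq.trans borel_eq_generateFrom_isClosed) isPiSystem_isClosed
    fun F hF => ?_
  refine measurable_of_tendsto_metrizable
    (f := fun n a => ∫⁻ x, hF.apprSeq n x ∂(σ a : Measure X)) (fun n => ?_) ?_
  · exact ((ProbabilityMeasure.continuous_lintegral_boundedContinuousFunction _).comp hσ).measurable
  · rw [tendsto_pi_nhds]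
    exact fun a => HasOuterApproxClosed.tendsto_lintegral_apprSeq hF _

end Convergence

end Kac

namespace Kac

section Lagrangian

variable {V lam : ℝ}

theorem integrable_continuousMap_phase (σ : ProbabilityMeasure (Phase V)) (f : C(Phase V, ℝ)) :
    Integrable f (σ : Measure (Phase V)) :=
  Integrable.of_bound f.continuous.aestronglyMeasurable ‖f‖
    (Eventually.of_forall f.norm_coe_le_norm)

/-- The Lagrangian penalises the deviation of `j₁` from `v σ`. -/
theorem ofReal_mul_abs_sub_le_lagrangian (σ : ProbabilityMeasure (Phase V))
    (j₁ j₂ : SignedMeasure (Phase V)) (ψ : C(Phase V, ℝ)) (a : ℝ) :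
    ENNReal.ofReal (a * |∫ᵛ p, ψ p ∂•j₁ - ∫ p, (p.2 : ℝ) * ψ p ∂(σ : Measure (Phase V))|) ≤
      lagrangian V lam (σ : Measure (Phase V)) j₁ j₂ := by
  set D := ∫ᵛ p, ψ p ∂•j₁ - ∫ p, (p.2 : ℝ) * ψ p ∂(σ : Measure (Phase V)) with hD
  have key (c : ℝ) : ENNReal.ofReal (c * D) ≤ lagrangian V lam (σ : Measure (Phase V)) j₁ j₂ := by
    refine le_trans (le_of_eq ?_) (le_iSup _ ((c • ψ, 0) : C(Phase V, ℝ) × C(Phase V, ℝ)))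
    simp only [hamiltonian, ContinuousMap.coe_smul, Pi.smul_apply, smul_eq_mul,
      ContinuousMap.coe_zero, Pi.zero_apply, Real.exp_zero, sub_self, mul_zero, add_zero,
      SignedMeasure.integral_const_mul, VectorMeasure.integral_zero, mul_left_comm _ c,
      integral_const_mul]
    rw [hD, mul_sub]
  rcases abs_cases D with ⟨h, -⟩ | ⟨h, -⟩
  · rw [h]; exact key a
  · rw [h, mul_neg, ← neg_mul]; exact key (-a)

/-- The exponential bound for the reaction flux that follows from duality. -/
theorem ofReal_mul_abs_integral_sub_le_lagrangian (hlam : 0 ≤ lam)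
    (σ : ProbabilityMeasure (Phase V))
    (j₁ j₂ : SignedMeasure (Phase V)) (ψ : C(Phase V, ℝ)) {a M : ℝ} (ha : 0 ≤ a)
    (hM : ∀ p, |ψ p| ≤ M) :
    ENNReal.ofReal (a * |∫ᵛ p, ψ p ∂•j₂| - lam * (Real.exp (a * M) - 1)) ≤
      lagrangian V lam (σ : Measure (Phase V)) j₁ j₂ := by
  have key (c : ℝ) (hc : |c| ≤ a) :
      ENNReal.ofReal (c * ∫ᵛ p, ψ p ∂•j₂ - lam * (Real.exp (a * M) - 1)) ≤
        lagrangian V lam (σ : Measure (Phase V)) j₁ j₂ := by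
    refine le_trans ?_ (le_iSup _ ((0, c • ψ) : C(Phase V, ℝ) × C(Phase V, ℝ)))
    refine ENNReal.ofReal_le_ofReal ?_
    simp only [hamiltonian, ContinuousMap.coe_smul, Pi.smul_apply, smul_eq_mul,
      ContinuousMap.coe_zero, Pi.zero_apply, mul_zero, zero_add,
      SignedMeasure.integral_const_mul, VectorMeasure.integral_zero]
    refine sub_le_sub_left ?_ _
    have hbound : ∫ p, lam * (Real.exp (c * ψ p) - 1) ∂(σ : Measure (Phase V)) ≤
        ∫ _, lam * (Real.exp (a * M) - 1) ∂(σ : Measure (Phase V)) := by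
      refine integral_mono (integrable_continuousMap_phase σ
        ⟨fun p => lam * (Real.exp (c * ψ p) - 1), by fun_prop⟩) (integrable_const _) fun p => ?_
      have : c * ψ p ≤ a * M := (le_abs_self _).trans <| by
        rw [abs_mul]; exact mul_le_mul hc (hM p) (abs_nonneg _) ha
      dsimp only
      gcongr
    simpa using hbound
  rcases abs_cases (∫ᵛ p, ψ p ∂•j₂) with ⟨h, -⟩ | ⟨h, -⟩
  · rw [h]; exact key a (abs_of_nonneg ha).le
  · rw [h, mul_neg, ← neg_mul]; exact key (-a) (by rw [abs_neg, abs_of_nonneg ha])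

theorem ofReal_mul_lintegral_enorm_le {α : Type*} [MeasurableSpace α] {μ : Measure α}
    {G : α → ℝ} {L : α → ℝ≥0∞} {a K : ℝ} (ha : 0 ≤ a)
    (h : ∀ t, ENNReal.ofReal (a * |G t| - K) ≤ L t) :
    ENNReal.ofReal a * ∫⁻ t, ‖G t‖ₑ ∂μ ≤ ∫⁻ t, L t ∂μ + ENNReal.ofReal K * μ univ := by
  rw [← lintegral_const_mul' _ _ ENNReal.ofReal_ne_top, ← lintegral_const,
    ← lintegral_add_right _ measurable_const]
  refine lintegral_mono fun t => ?_
  calc ENNReal.ofReal a * ‖G t‖ₑ = ENNReal.ofReal (a * |G t| - K + K) := by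
        rw [Real.enorm_eq_ofReal_abs, ← ENNReal.ofReal_mul ha, sub_add_cancel]
    _ ≤ _ := ENNReal.ofReal_add_le.trans (by gcongr; exact h t)

end Lagrangian

section RateBounds

variable {V T lam : ℝ} {σ : ℝ → ProbabilityMeasure (Phase V)}
  {j₁ j₂ : ℝ → SignedMeasure (Phase V)}

theorem rate_eq_lintegral (h : ContinuityEq V T σ j₁ j₂) :
    rate V T lam σ j₁ j₂ =
      ∫⁻ t in Ioo (0 : ℝ) T, lagrangian V lam (σ t : Measure (Phase V)) (j₁ t) (j₂ t) :=
  if_pos h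

theorem IntegrableFamily.aemeasurable_integral {X : Type*} [MeasurableSpace X]
    {m : ℝ → SignedMeasure X} (hm : IntegrableFamily T m) {f : X → ℝ} (hf : Measurable f) (M : ℝ)
    (hM : ∀ x, |f x| ≤ M) :
    AEMeasurable (fun t => ∫ᵛ x, f x ∂•(m t)) (volume.restrict (Ioo 0 T)) :=
  aemeasurable_restrict_of_measurable_subtype measurableSet_Ioo
    (SignedMeasure.measurable_integral hm.1 hf M hM)

theorem ContinuityEq.continuousOn_integral (h : ContinuityEq V T σ j₁ j₂) (f : C(Phase V, ℝ)) :
    ContinuousOn (fun t => ∫ p, f p ∂(σ t : Measure (Phase V))) (Icc 0 T) :=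
  (ProbabilityMeasure.continuous_integral_continuousMap f).comp_continuousOn h.continuousOn

/-- Finite rate forces `j₁ = v σ` for almost every time, in the weak sense. -/
theorem ContinuityEq.integral_flux_ae (h : ContinuityEq V T σ j₁ j₂)
    (hfin : rate V T lam σ j₁ j₂ ≠ ∞) (ψ : C(Phase V, ℝ)) :
    ∀ᵐ t ∂(volume.restrict (Ioo (0 : ℝ) T)),
      ∫ᵛ p, ψ p ∂•(j₁ t) = ∫ p, (p.2 : ℝ) * ψ p ∂(σ t : Measure (Phase V)) := by
  set D : ℝ → ℝ := fun t => ∫ᵛ p, ψ p ∂•(j₁ t) - ∫ p, (p.2 : ℝ) * ψ p ∂(σ t : Measure (Phase V))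
  have hD : AEMeasurable D (volume.restrict (Ioo 0 T)) := by
    refine (h.integrable₁.aemeasurable_integral ψ.continuous.measurable ‖ψ‖
      ψ.norm_coe_le_norm).sub ?_
    exact ((h.continuousOn_integral (velocityMap V * ψ)).mono Ioo_subset_Icc_self).aemeasurable
      measurableSet_Ioo
  rw [rate_eq_lintegral h] at hfin
  have hle (n : ℕ) : (n : ℝ≥0∞) * ∫⁻ t in Ioo (0 : ℝ) T, ‖D t‖ₑ ≤
      ∫⁻ t in Ioo (0 : ℝ) T, lagrangian V lam (σ t : Measure (Phase V)) (j₁ t) (j₂ t) := by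
    have hL (t : ℝ) : ENNReal.ofReal (n * |D t| - 0) ≤
        lagrangian V lam (σ t : Measure (Phase V)) (j₁ t) (j₂ t) := by
      rw [sub_zero]
      exact ofReal_mul_abs_sub_le_lagrangian (σ t) (j₁ t) (j₂ t) ψ n
    have := ofReal_mul_lintegral_enorm_le (μ := volume.restrict (Ioo (0 : ℝ) T))
      (Nat.cast_nonneg n) hL
    simpa using this
  have hzero : ∫⁻ t in Ioo (0 : ℝ) T, ‖D t‖ₑ = 0 := by
    by_contra hne
    obtain ⟨n, hn⟩ := ENNReal.exists_nat_mul_gt hne hfin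
    exact absurd (hle n) (not_le.2 hn)
  filter_upwards [(lintegral_eq_zero_iff' hD.enorm).1 hzero] with t ht
  exact sub_eq_zero.1 (by simpa using ht)

theorem abs_velocity (hV : 0 ≤ V) (v : Velocity V) : |(v : ℝ)| = V := by
  rcases v.2 with h | h
  · rw [h, abs_neg, abs_of_nonneg hV]
  · rw [mem_singleton_iff.1 h, abs_of_nonneg hV]

/-- Bound for time-dependent test functions against the reaction momentum `∑ v j₂(·, v)`. -/
theorem lintegral_firstMoment_le (hV : 0 ≤ V) (hlam : 0 ≤ lam) (h : ContinuityEq V T σ j₁ j₂)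
    (ψ : ℝ → C(Torus, ℝ)) {a M : ℝ} (ha : 0 ≤ a) (hM : ∀ t x, |ψ t x| ≤ M) :
    ENNReal.ofReal a * ∫⁻ t in Ioo (0 : ℝ) T, ‖∫ᵛ x, ψ t x ∂•(firstMoment (j₂ t))‖ₑ ≤
      rate V T lam σ j₁ j₂ +
        ENNReal.ofReal (lam * (Real.exp (a * (V * M)) - 1)) * ENNReal.ofReal T := by
  have := ofReal_mul_lintegral_enorm_le (μ := volume.restrict (Ioo (0 : ℝ) T)) ha fun t =>
    ofReal_mul_abs_integral_sub_le_lagrangian (M := V * M) hlam (σ t) (j₁ t) (j₂ t)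
      (velocityMap V * (ψ t).comp ContinuousMap.fst) ha fun p => by
        simp only [ContinuousMap.mul_apply, velocityMap_apply, abs_mul, abs_velocity hV]
        exact mul_le_mul_of_nonneg_left (hM _ _) hV
  rw [rate_eq_lintegral h]
  simpa [integral_firstMoment] using this

end RateBounds

end Kac

namespace Kac

section WeakEquations

variable {V T lam : ℝ} {σ : ℝ → ProbabilityMeasure (Phase V)}
  {j₁ j₂ : ℝ → SignedMeasure (Phase V)}

theorem uIoc_subset_Ioc_of_mem_Icc {s t : ℝ} (hs : s ∈ Icc 0 T) (ht : t ∈ Icc 0 T) :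
    uIoc s t ⊆ Ioc 0 T :=
  Ioc_subset_Ioc (le_min hs.1 ht.1) (max_le hs.2 ht.2)

theorem restrict_uIoc_le {s t : ℝ} (hs : s ∈ Icc 0 T) (ht : t ∈ Icc 0 T) :
    (volume : Measure ℝ).restrict (uIoc s t) ≤ volume.restrict (Ioo 0 T) := by
  rw [Measure.restrict_congr_set (Ioo_ae_eq_Ioc (a := (0 : ℝ)) (b := T))]
  exact Measure.restrict_mono_set _ (uIoc_subset_Ioc_of_mem_Icc hs ht)

theorem ae_uIoc_of_ae_Ioo {p : ℝ → Prop} (h : ∀ᵐ t ∂(volume.restrict (Ioo (0 : ℝ) T)), p t)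
    {s t : ℝ} (hs : s ∈ Icc 0 T) (ht : t ∈ Icc 0 T) : ∀ᵐ r, r ∈ uIoc s t → p r :=
  (ae_restrict_iff' measurableSet_uIoc).1 (ae_mono (restrict_uIoc_le hs ht) h)

theorem enorm_intervalIntegral_le_lintegral {s t : ℝ} (hs : s ∈ Icc 0 T) (ht : t ∈ Icc 0 T)
    (G : ℝ → ℝ) : ‖∫ r in s..t, G r‖ₑ ≤ ∫⁻ r in Ioo (0 : ℝ) T, ‖G r‖ₑ := by
  rw [← ofReal_norm, intervalIntegral.norm_intervalIntegral_eq, ofReal_norm]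
  exact (enorm_integral_le_lintegral_enorm _).trans
    (lintegral_mono' (restrict_uIoc_le hs ht) le_rfl)

theorem intervalIntegrable_of_continuousOn_Icc {g : ℝ → ℝ} (hg : ContinuousOn g (Icc 0 T))
    {s t : ℝ} (hs : s ∈ Icc 0 T) (ht : t ∈ Icc 0 T) : IntervalIntegrable g volume s t :=
  (hg.mono (ordConnected_Icc.uIcc_subset hs ht)).intervalIntegrable

theorem ContinuityEq.continuousOn_integral_flux (h : ContinuityEq V T σ j₁ j₂) (f : C(Torus, ℝ)) :
    ContinuousOn (fun t => ∫ᵛ x, f x ∂•(flux (σ t))) (Icc 0 T) := by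
  simp_rw [integral_flux]
  exact h.continuousOn_integral (velocityMap V * f.comp ContinuousMap.fst)

theorem ContinuityEq.continuousOn_integral_density (h : ContinuityEq V T σ j₁ j₂)
    (f : C(Torus, ℝ)) :
    ContinuousOn (fun t => ∫ x, f x ∂(density (σ t) : Measure Torus)) (Icc 0 T) := by
  simp_rw [integral_density]
  exact h.continuousOn_integral (f.comp ContinuousMap.fst)

theorem ContinuityEq.weak_of_mem (h : ContinuityEq V T σ j₁ j₂) {φ φ' : C(Phase V, ℝ)}
    (hφ : HasPhaseDeriv V φ φ') {s t : ℝ} (hs : s ∈ Icc 0 T) (ht : t ∈ Icc 0 T) :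
    ∫ p, φ p ∂(σ t : Measure (Phase V)) - ∫ p, φ p ∂(σ s : Measure (Phase V)) =
      ∫ r in s..t, (∫ᵛ p, φ' p ∂•(j₁ r) + ∫ᵛ p, (φ (reversal V p) - φ p) ∂•(j₂ r)) := by
  rcases le_total s t with hst | hst
  · exact h.weak φ φ' hφ s t hs.1 hst ht.2
  · rw [intervalIntegral.integral_symm, ← h.weak φ φ' hφ t s ht.1 hst hs.2, neg_sub]

/-- Conservation of mass: `∂ₜ ρ + ∂ₓ ω = 0`. -/
theorem ContinuityEq.weak_density (h : ContinuityEq V T σ j₁ j₂)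
    (hfin : rate V T lam σ j₁ j₂ ≠ ∞) {a a' : C(Torus, ℝ)} (ha : HasTorusDeriv a a') {s t : ℝ}
    (hs : s ∈ Icc 0 T) (ht : t ∈ Icc 0 T) :
    ∫ x, a x ∂(density (σ t) : Measure Torus) - ∫ x, a x ∂(density (σ s) : Measure Torus) =
      ∫ r in s..t, ∫ᵛ x, a' x ∂•(flux (σ r)) := by
  have hweak := h.weak_of_mem (HasPhaseDeriv.of_torus ha) hs ht
  simp only [ContinuousMap.comp_apply, ContinuousMap.fst_apply] at hweak
  rw [integral_density, integral_density, hweak]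
  refine intervalIntegral.integral_congr_ae ?_
  filter_upwards [ae_uIoc_of_ae_Ioo (h.integral_flux_ae hfin (a'.comp ContinuousMap.fst)) hs ht]
    with r hr hrmem
  have := hr hrmem
  simp only [ContinuousMap.comp_apply, ContinuousMap.fst_apply] at this
  rw [this, integral_flux]
  simp [reversal]

theorem integral_velocity_sq_mul (hV : 0 ≤ V) (τ : ProbabilityMeasure (Phase V))
    (b : C(Torus, ℝ)) :
    ∫ p, (p.2 : ℝ) * ((p.2 : ℝ) * b p.1) ∂(τ : Measure (Phase V)) =
      V ^ 2 * ∫ x, b x ∂(density τ : Measure Torus) := by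
  rw [integral_density, ← integral_const_mul]
  refine integral_congr_ae (Eventually.of_forall fun p => ?_)
  dsimp only
  rw [← mul_assoc, ← sq, ← sq_abs, abs_velocity hV]

/-- The momentum balance `∂ₜ ω + V² ∂ₓ ρ = -2 J`. -/
theorem ContinuityEq.weak_flux (hV : 0 ≤ V) (hlam : 0 ≤ lam) (h : ContinuityEq V T σ j₁ j₂)
    (hfin : rate V T lam σ j₁ j₂ ≠ ∞) {b b' : C(Torus, ℝ)} (hb : HasTorusDeriv b b') {s t : ℝ}
    (hs : s ∈ Icc 0 T) (ht : t ∈ Icc 0 T) :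
    ∫ᵛ x, b x ∂•(flux (σ t)) - ∫ᵛ x, b x ∂•(flux (σ s)) =
      V ^ 2 * (∫ r in s..t, ∫ x, b' x ∂(density (σ r) : Measure Torus)) -
        2 * ∫ r in s..t, ∫ᵛ x, b x ∂•(firstMoment (j₂ r)) := by
  have hweak := h.weak_of_mem (HasPhaseDeriv.velocity_mul (V := V) hb) hs ht
  simp only [ContinuousMap.mul_apply, velocityMap_apply, ContinuousMap.comp_apply,
    ContinuousMap.fst_apply] at hweak
  have hG : IntegrableOn (fun r => ∫ᵛ x, b x ∂•(firstMoment (j₂ r))) (Ioo 0 T) := by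
    refine ⟨?_, ?_⟩
    · simp_rw [integral_firstMoment]
      exact (h.integrable₂.aemeasurable_integral
        (velocityMap V * b.comp ContinuousMap.fst).continuous.measurable _
        (velocityMap V * b.comp ContinuousMap.fst).norm_coe_le_norm).aestronglyMeasurable
    · have := lintegral_firstMoment_le hV hlam h (fun _ => b) zero_le_one
        fun _ => b.norm_coe_le_norm
      rw [ENNReal.ofReal_one, one_mul] at this
      exact this.trans_lt (ENNReal.add_lt_top.2 ⟨hfin.lt_top,
        ENNReal.mul_lt_top ENNReal.ofReal_lt_top ENNReal.ofReal_lt_top⟩)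
  have hG' : IntervalIntegrable (fun r => ∫ᵛ x, b x ∂•(firstMoment (j₂ r))) volume s t := by
    rw [intervalIntegrable_iff]
    exact Integrable.mono_measure hG (restrict_uIoc_le hs ht)
  rw [integral_flux, integral_flux, hweak, ← intervalIntegral.integral_const_mul,
    ← intervalIntegral.integral_const_mul, ← intervalIntegral.integral_sub
      ((intervalIntegrable_of_continuousOn_Icc
        (h.continuousOn_integral_density b') hs ht).const_mul _)
      (hG'.const_mul _)]
  refine intervalIntegral.integral_congr_ae ?_
  filter_upwards [ae_uIoc_of_ae_Ioo (h.integral_flux_ae hfin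
    (velocityMap V * b'.comp ContinuousMap.fst)) hs ht] with r hr hrmem
  have := hr hrmem
  simp only [ContinuousMap.mul_apply, velocityMap_apply, ContinuousMap.comp_apply,
    ContinuousMap.fst_apply] at this
  rw [this, integral_velocity_sq_mul hV, integral_firstMoment, sub_eq_add_neg, ← neg_mul,
    ← SignedMeasure.integral_const_mul]
  congr 2
  ext p
  simp only [reversal]
  ring

end WeakEquations

section Vanishing

variable {ι : Type*} {l : Filter ι} {V T : ℝ} {lam : ι → ℝ}
  {σ : ι → ℝ → ProbabilityMeasure (Phase V)}
  {j₁ j₂ : ι → ℝ → SignedMeasure (Phase V)}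

/-- Under a uniform bound on the rate, the reaction momentum vanishes as `lam → 0`, tested against
uniformly bounded functions. -/
theorem tendsto_lintegral_firstMoment (hV : 0 ≤ V) (hlam_nonneg : ∀ i, 0 ≤ lam i)
    (hlam : Tendsto lam l (𝓝 0)) (hCE : ∀ i, ContinuityEq V T (σ i) (j₁ i) (j₂ i)) {C : ℝ≥0∞}
    (hC : C ≠ ∞) (hrate : ∀ i, rate V T (lam i) (σ i) (j₁ i) (j₂ i) ≤ C)
    (ψ : ℝ → C(Torus, ℝ)) {M : ℝ} (hM : ∀ t x, |ψ t x| ≤ M) :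
    Tendsto (fun i => ∫⁻ t in Ioo (0 : ℝ) T, ‖∫ᵛ x, ψ t x ∂•(firstMoment (j₂ i t))‖ₑ) l
      (𝓝 0) := by
  rw [ENNReal.tendsto_nhds_zero]
  intro ε hε
  obtain ⟨n, hn⟩ := ENNReal.exists_nat_mul_gt hε.ne' (ENNReal.add_ne_top.2 ⟨hC, ENNReal.one_ne_top⟩)
  have hsmall : Tendsto (fun i => ENNReal.ofReal (lam i * (Real.exp (n * (V * M)) - 1)) *
      ENNReal.ofReal T) l (𝓝 0) := by
    have h1 := (ENNReal.tendsto_ofReal (hlam.mul_const (Real.exp (n * (V * M)) - 1)))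
    rw [zero_mul, ENNReal.ofReal_zero] at h1
    simpa using ENNReal.Tendsto.mul_const h1 (Or.inr (ENNReal.ofReal_ne_top (r := T)))
  filter_upwards [ENNReal.tendsto_nhds_zero.1 hsmall 1 one_pos] with i hi
  have hle := lintegral_firstMoment_le hV (hlam_nonneg i) (hCE i) ψ (Nat.cast_nonneg n) hM
  rw [ENNReal.ofReal_natCast] at hle
  by_contra! hlt
  have : (n : ℝ≥0∞) * ε ≤ C + 1 :=
    (mul_le_mul_right hlt.le _).trans (hle.trans (add_le_add (hrate i) hi))
  exact absurd hn (not_lt.2 this)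

end Vanishing

end Kac

namespace Kac

section Disintegration

variable {V T : ℝ}

instance (T : ℝ) : IsFiniteMeasure (timeMeasure T) := by
  refine ⟨?_⟩
  rw [timeMeasure, comap_subtype_coe_apply measurableSet_Ioo, image_univ, Subtype.range_coe]
  exact measure_Ioo_lt_top

theorem integral_timeMeasure (g : ℝ → ℝ) :
    ∫ t : Ioo (0 : ℝ) T, g t ∂(timeMeasure T) = ∫ t in Ioo (0 : ℝ) T, g t :=
  integral_subtype_comap measurableSet_Ioo g

theorem lintegral_timeMeasure (g : ℝ → ℝ≥0∞) :
    ∫⁻ t : Ioo (0 : ℝ) T, g t ∂(timeMeasure T) = ∫⁻ t in Ioo (0 : ℝ) T, g t :=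
  lintegral_subtype_comap measurableSet_Ioo g

/-- The measure `σ(dx, v)` on the torus, at a fixed velocity `v`. -/
noncomputable def velocitySlice (v : Velocity V) (τ : Measure (Phase V)) : Measure Torus :=
  (τ.restrict (univ ×ˢ {v})).map Prod.fst

theorem measurableSet_velocityFiber (v : Velocity V) :
    MeasurableSet ((univ : Set Torus) ×ˢ ({v} : Set (Velocity V))) :=
  MeasurableSet.univ.prod (measurableSet_singleton v)

theorem velocitySlice_apply (v : Velocity V) (τ : Measure (Phase V)) {A : Set Torus}
    (hA : MeasurableSet A) :
    velocitySlice v τ A = τ (Prod.fst ⁻¹' A ∩ univ ×ˢ {v}) := by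
  rw [velocitySlice, Measure.map_apply measurable_fst hA,
    Measure.restrict_apply (measurable_fst hA)]

instance (v : Velocity V) (τ : Measure (Phase V)) [IsFiniteMeasure τ] :
    IsFiniteMeasure (velocitySlice v τ) := by
  unfold velocitySlice; infer_instance

theorem velocitySlice_univ_le_one (v : Velocity V) (τ : Measure (Phase V))
    [IsProbabilityMeasure τ] : velocitySlice v τ univ ≤ 1 := by
  rw [velocitySlice_apply v τ MeasurableSet.univ]
  exact prob_le_one

theorem measurable_velocitySlice (v : Velocity V) : Measurable (velocitySlice v) := by
  refine Measure.measurable_of_measurable_coe _ fun A hA => ?_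
  simp_rw [velocitySlice_apply v _ hA]
  exact Measure.measurable_coe ((measurable_fst hA).inter (measurableSet_velocityFiber v))

theorem flux_eq_sum (τ : ProbabilityMeasure (Phase V)) :
    flux τ = ∑ v : Velocity V, (v : ℝ) •
      (velocitySlice v (τ : Measure (Phase V))).toSignedMeasure := by
  rw [flux, firstMoment]
  refine Finset.sum_congr rfl fun v _ => ?_
  congr 1
  refine VectorMeasure.ext fun A hA => ?_
  rw [slice, VectorMeasure.map_apply _ measurable_fst hA,
    VectorMeasure.restrict_apply _ (measurableSet_velocityFiber v) (measurable_fst hA),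
    Measure.toSignedMeasure_apply_measurable
      ((measurable_fst hA).inter (measurableSet_velocityFiber v)),
    Measure.toSignedMeasure_apply_measurable hA, measureReal_def, measureReal_def,
    velocitySlice_apply v _ hA]

theorem flux_apply (τ : ProbabilityMeasure (Phase V)) {A : Set Torus} (hA : MeasurableSet A) :
    flux τ A = ∑ v : Velocity V, (v : ℝ) * (velocitySlice v (τ : Measure (Phase V))).real A := by
  rw [flux_eq_sum, FunLike.coe_sum, Finset.sum_apply]
  refine Finset.sum_congr rfl fun v _ => ?_
  rw [smul_apply, Measure.toSignedMeasure_apply_measurable hA, smul_eq_mul]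

theorem integral_flux_eq_sum (τ : ProbabilityMeasure (Phase V)) (f : C(Torus, ℝ)) :
    ∫ᵛ x, f x ∂•(flux τ) =
      ∑ v : Velocity V, (v : ℝ) * ∫ x, f x ∂(velocitySlice v (τ : Measure (Phase V))) := by
  rw [flux_eq_sum, VectorMeasure.integral_finsetSum_vectorMeasure
    (fun v _ => SignedMeasure.integrable_continuousMap _ f)]
  refine Finset.sum_congr rfl fun v _ => ?_
  rw [VectorMeasure.integral_smul_vectorMeasure, SignedMeasure.integral_toSignedMeasure_real,
    smul_eq_mul]

theorem totalVariation_flux_univ_le (τ : ProbabilityMeasure (Phase V)) :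
    (flux τ).totalVariation univ ≤ ∑ v : Velocity V, ‖(v : ℝ)‖ₑ := by
  rw [SignedMeasure.totalVariation_eq_variation, flux_eq_sum]
  refine (VectorMeasure.variation_finsetSum_le _ _ univ).trans ?_
  rw [Measure.coe_finsetSum, Finset.sum_apply]
  refine Finset.sum_le_sum fun v _ => ?_
  rw [VectorMeasure.variation_smul, Measure.variation_toSignedMeasure]
  refine (mul_le_mul_right (velocitySlice_univ_le_one v _) _).trans ?_
  simp [enorm]

theorem measurable_velocitySlice_curve {σ : ℝ → ProbabilityMeasure (Phase V)}
    (hσ : ContinuousOn σ (Ioo 0 T)) (v : Velocity V) :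
    Measurable fun t : Ioo (0 : ℝ) T => velocitySlice v (σ t : Measure (Phase V)) :=
  (measurable_velocitySlice v).comp
    (measurable_toMeasure_of_continuous (continuousOn_iff_continuous_domRestrict.1 hσ))

/-- The slices at velocity `v` of a narrowly continuous curve, as a kernel. -/
noncomputable def velocityKernel {σ : ℝ → ProbabilityMeasure (Phase V)}
    (hσ : ContinuousOn σ (Ioo 0 T)) (v : Velocity V) :
    ProbabilityTheory.Kernel (Ioo (0 : ℝ) T) Torus :=
  ⟨fun t => velocitySlice v (σ t : Measure (Phase V)), measurable_velocitySlice_curve hσ v⟩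

instance {σ : ℝ → ProbabilityMeasure (Phase V)} (hσ : ContinuousOn σ (Ioo 0 T)) (v : Velocity V) :
    ProbabilityTheory.IsFiniteKernel (velocityKernel hσ v) :=
  ⟨1, ENNReal.one_lt_top, fun _ => velocitySlice_univ_le_one v _⟩

theorem integrable_boundedContinuous_compProd {σ : ℝ → ProbabilityMeasure (Phase V)}
    (hσ : ContinuousOn σ (Ioo 0 T)) (f : (Ioo (0 : ℝ) T × Torus) →ᵇ ℝ) (v : Velocity V) :
    Integrable f ((timeMeasure T).compProd (velocityKernel hσ v)) :=
  Integrable.of_bound f.continuous.aestronglyMeasurable ‖f‖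
    (Eventually.of_forall f.norm_coe_le_norm)

theorem integrable_integral_velocitySlice {σ : ℝ → ProbabilityMeasure (Phase V)}
    (hσ : ContinuousOn σ (Ioo 0 T)) (f : (Ioo (0 : ℝ) T × Torus) →ᵇ ℝ) (v : Velocity V) :
    Integrable (fun t : Ioo (0 : ℝ) T =>
      ∫ x, f (t, x) ∂(velocitySlice v (σ t : Measure (Phase V)))) (timeMeasure T) := by
  simpa [velocityKernel] using
    Integrable.integral_compProd (integrable_boundedContinuous_compProd hσ f v)

theorem integral_flux_section_eq_sum (τ : ProbabilityMeasure (Phase V))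
    (f : (Ioo (0 : ℝ) T × Torus) →ᵇ ℝ) (t : Ioo (0 : ℝ) T) :
    ∫ᵛ x, f (t, x) ∂•(flux τ) =
      ∑ v : Velocity V, (v : ℝ) * ∫ x, f (t, x) ∂(velocitySlice v (τ : Measure (Phase V))) :=
  integral_flux_eq_sum τ ⟨fun x => f (t, x), by fun_prop⟩

theorem integrable_integral_flux {σ : ℝ → ProbabilityMeasure (Phase V)}
    (hσ : ContinuousOn σ (Ioo 0 T)) (f : (Ioo (0 : ℝ) T × Torus) →ᵇ ℝ) :
    Integrable (fun t : Ioo (0 : ℝ) T => ∫ᵛ x, f (t, x) ∂•(flux (σ t))) (timeMeasure T) := by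
  simp_rw [integral_flux_section_eq_sum]
  exact integrable_finsetSum _ fun v _ => (integrable_integral_velocitySlice hσ f v).const_mul _

/-- A measure on `(0,T) × 𝕋` is disintegrated by the fluxes of a narrowly continuous curve as soon
as this holds when tested against bounded continuous functions. -/
theorem disintegrates_flux {σ : ℝ → ProbabilityMeasure (Phase V)}
    (hσ : ContinuousOn σ (Ioo 0 T)) {μ : SignedMeasure (Ioo (0 : ℝ) T × Torus)}
    (h : ∀ f : (Ioo (0 : ℝ) T × Torus) →ᵇ ℝ, ∫ᵛ z, f z ∂•μ =
      ∫ t : Ioo (0 : ℝ) T, ∫ᵛ x, f (t, x) ∂•(flux (σ t)) ∂(timeMeasure T)) :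
    Disintegrates T μ fun t => flux (σ t) := by
  have hμ : μ = ∑ v : Velocity V,
      (v : ℝ) • ((timeMeasure T).compProd (velocityKernel hσ v)).toSignedMeasure := by
    refine SignedMeasure.ext_of_forall_integral_eq fun f => ?_
    rw [h f, VectorMeasure.integral_finsetSum_vectorMeasure
      (fun v _ => SignedMeasure.integrable_boundedContinuous _ f)]
    simp_rw [integral_flux_section_eq_sum]
    rw [integral_finsetSum _ fun v _ => (integrable_integral_velocitySlice hσ f v).const_mul _]
    refine Finset.sum_congr rfl fun v _ => ?_
    rw [VectorMeasure.integral_smul_vectorMeasure, SignedMeasure.integral_toSignedMeasure_real,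
      Measure.integral_compProd (integrable_boundedContinuous_compProd hσ f v),
      integral_const_mul, smul_eq_mul]
    rfl
  refine ⟨⟨fun A hA => ?_, ?_⟩, fun A hA => ?_⟩
  · simp_rw [flux_apply _ hA]
    exact Finset.measurable_sum _ fun v _ =>
      ((Measure.measurable_coe hA).comp
        (measurable_velocitySlice_curve hσ v)).ennreal_toReal.const_mul _
  · refine (lintegral_mono fun t => totalVariation_flux_univ_le (σ t)).trans_lt ?_
    rw [lintegral_const]
    refine ENNReal.mul_lt_top (ENNReal.sum_lt_top.2 fun v _ => enorm_lt_top) (by simp)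
  · have hA' (t : Ioo (0 : ℝ) T) : MeasurableSet {x | (t, x) ∈ A} := measurable_prodMk_left hA
    simp_rw [flux_apply _ (hA' _)]
    have hreal (v : Velocity V) : Integrable
        (fun t : Ioo (0 : ℝ) T =>
          (velocitySlice v (σ t : Measure (Phase V))).real {x | (t, x) ∈ A}) (timeMeasure T) := by
      refine Integrable.of_bound (C := 1)
        (ProbabilityTheory.Kernel.measurable_kernel_prodMk_left
          (κ := velocityKernel hσ v) hA).ennreal_toReal.aestronglyMeasurable
        (Eventually.of_forall fun t => ?_)
      rw [Real.norm_of_nonneg measureReal_nonneg]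
      exact ENNReal.toReal_le_of_le_ofReal zero_le_one (by
        rw [ENNReal.ofReal_one]
        exact (measure_mono (subset_univ _)).trans (velocitySlice_univ_le_one v _))
    rw [integral_finsetSum _ fun v _ => (hreal v).const_mul _, hμ, FunLike.coe_sum,
      Finset.sum_apply]
    refine Finset.sum_congr rfl fun v _ => ?_
    rw [smul_apply, Measure.toSignedMeasure_apply_measurable hA, smul_eq_mul,
      integral_const_mul, measureReal_def, Measure.compProd_apply hA,
      ← integral_toReal (ProbabilityTheory.Kernel.measurable_kernel_prodMk_left
          (κ := velocityKernel hσ v) hA).aemeasurable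
        (Eventually.of_forall fun t => measure_lt_top _ _)]
    rfl

end Disintegration

end Kac

namespace Kac

section LimitPassage

variable {ι : Type*} {l : Filter ι} [l.IsCountablyGenerated] {T : ℝ}

theorem tendsto_intervalIntegral_of_bound {F : ι → ℝ → ℝ} {g : ℝ → ℝ} {M : ℝ}
    (hF : ∀ i, ContinuousOn (F i) (Icc 0 T)) (hM : ∀ i, ∀ t ∈ Icc 0 T, |F i t| ≤ M)
    (hlim : ∀ t ∈ Icc 0 T, Tendsto (fun i => F i t) l (𝓝 (g t))) {s t : ℝ} (hs : s ∈ Icc 0 T)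
    (ht : t ∈ Icc 0 T) :
    Tendsto (fun i => ∫ r in s..t, F i r) l (𝓝 (∫ r in s..t, g r)) := by
  have hsub : uIoc s t ⊆ Icc 0 T := (uIoc_subset_Ioc_of_mem_Icc hs ht).trans Ioc_subset_Icc_self
  refine intervalIntegral.tendsto_integral_filter_of_dominated_convergence (fun _ => M)
    (Eventually.of_forall fun i => ((hF i).mono hsub).aestronglyMeasurable measurableSet_uIoc)
    (Eventually.of_forall fun i => Eventually.of_forall fun r hr => hM i r (hsub hr))
    intervalIntegrable_const (Eventually.of_forall fun r hr => hlim r (hsub hr))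

/-- If the increments and the time average of uniformly bounded continuous functions converge, then
the functions converge pointwise. -/
theorem exists_tendsto_of_increments (hT : 0 < T) {W : ι → ℝ → ℝ} {M c : ℝ} {D : ℝ → ℝ → ℝ}
    (hW : ∀ i, ContinuousOn (W i) (Icc 0 T)) (hM : ∀ i, ∀ t ∈ Icc 0 T, |W i t| ≤ M)
    (hD : ∀ s ∈ Icc 0 T, ∀ t ∈ Icc 0 T, Tendsto (fun i => W i t - W i s) l (𝓝 (D s t)))
    (hc : Tendsto (fun i => ∫ s in (0 : ℝ)..T, W i s) l (𝓝 c)) {t : ℝ} (ht : t ∈ Icc 0 T) :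
    ∃ w, Tendsto (fun i => W i t) l (𝓝 w) := by
  have h0 : (0 : ℝ) ∈ Icc 0 T := left_mem_Icc.2 hT.le
  have hT' : T ∈ Icc 0 T := right_mem_Icc.2 hT.le
  have hinc := tendsto_intervalIntegral_of_bound (l := l) (F := fun i s => W i t - W i s)
    (g := fun s => D s t) (M := M + M) (fun i => continuousOn_const.sub (hW i))
    (fun i s hs => (abs_sub _ _).trans (add_le_add (hM i t ht) (hM i s hs)))
    (fun s hs => hD s hs t ht) h0 hT'
  refine ⟨_, ((hinc.add hc).const_mul T⁻¹).congr fun i => ?_⟩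
  rw [intervalIntegral.integral_sub intervalIntegrable_const
    (intervalIntegrable_of_continuousOn_Icc (hW i) h0 hT'), sub_add_cancel,
    intervalIntegral.integral_const, sub_zero, smul_eq_mul, inv_mul_cancel_left₀ hT.ne']

theorem continuousOn_of_integral_eq {u g : ℝ → ℝ} {M : ℝ} (hg : ∀ t ∈ Icc 0 T, |g t| ≤ M)
    (h : ∀ s ∈ Icc 0 T, ∀ t ∈ Icc 0 T, u t - u s = ∫ r in s..t, g r) :
    ContinuousOn u (Icc 0 T) := by
  rcases (Icc 0 T).eq_empty_or_nonempty with he | ⟨t₀, ht₀⟩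
  · rw [he]; exact continuousOn_empty u
  refine (LipschitzOnWith.of_dist_le_mul (K := ⟨M, (abs_nonneg _).trans (hg t₀ ht₀)⟩)
    fun t ht s hs => ?_).continuousOn
  rw [dist_eq_norm, h s hs t ht, Real.dist_eq]
  exact intervalIntegral.norm_integral_le_of_norm_le_const fun r hr =>
    hg r (Ioc_subset_Icc_self (uIoc_subset_Ioc_of_mem_Icc hs ht hr))

end LimitPassage

section Bounds

variable {V : ℝ}

theorem abs_integral_density_le (τ : ProbabilityMeasure (Phase V)) (f : C(Torus, ℝ)) :
    |∫ x, f x ∂(density τ : Measure Torus)| ≤ ‖f‖ := by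
  simpa using norm_integral_le_of_norm_le_const (μ := (density τ : Measure Torus))
    (Eventually.of_forall f.norm_coe_le_norm)

theorem abs_integral_flux_le (hV : 0 ≤ V) (τ : ProbabilityMeasure (Phase V)) (f : C(Torus, ℝ)) :
    |∫ᵛ x, f x ∂•(flux τ)| ≤ V * ‖f‖ := by
  rw [integral_flux]
  have : ∀ p : Phase V, ‖(p.2 : ℝ) * f p.1‖ ≤ V * ‖f‖ := fun p => by
    rw [norm_mul, Real.norm_eq_abs, abs_velocity hV]
    exact mul_le_mul_of_nonneg_left (f.norm_coe_le_norm _) hV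
  simpa using norm_integral_le_of_norm_le_const (μ := (τ : Measure (Phase V)))
    (Eventually.of_forall this)

theorem continuous_density : Continuous (density : ProbabilityMeasure (Phase V) → _) :=
  ProbabilityMeasure.continuous_map continuous_fst

theorem continuous_integral_flux (f : C(Torus, ℝ)) :
    Continuous fun τ : ProbabilityMeasure (Phase V) => ∫ᵛ x, f x ∂•(flux τ) := by
  simp_rw [integral_flux]
  exact ProbabilityMeasure.continuous_integral_continuousMap
    (velocityMap V * f.comp ContinuousMap.fst)

theorem continuous_integral_density (f : C(Torus, ℝ)) :
    Continuous fun τ : ProbabilityMeasure (Phase V) => ∫ x, f x ∂(density τ : Measure Torus) := by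
  simp_rw [integral_density]
  exact ProbabilityMeasure.continuous_integral_continuousMap (f.comp ContinuousMap.fst)

theorem integral_eq_density_add_flux (τ : ProbabilityMeasure (Phase V)) {φ : C(Phase V, ℝ)}
    {a b : C(Torus, ℝ)} (h : ∀ p, φ p = a p.1 + (p.2 : ℝ) * b p.1) :
    ∫ p, φ p ∂(τ : Measure (Phase V)) =
      ∫ x, a x ∂(density τ : Measure Torus) + ∫ᵛ x, b x ∂•(flux τ) := by
  rw [integral_density, integral_flux]
  simp_rw [h]
  exact integral_add (integrable_continuousMap_phase τ (a.comp ContinuousMap.fst))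
    (integrable_continuousMap_phase τ (velocityMap V * b.comp ContinuousMap.fst))

end Bounds

section HyperbolicLimit

variable {ι : Type*} {l : Filter ι} {V T : ℝ} {lam : ι → ℝ}
  {σ : ι → ℝ → ProbabilityMeasure (Phase V)} {j₁ j₂ : ι → ℝ → SignedMeasure (Phase V)}

/-- The limit of the reaction momenta vanishes. -/
theorem eq_zero_of_spaceTimeTendsto_firstMoment [l.NeBot] (hV : 0 ≤ V)
    (hlam_nonneg : ∀ i, 0 ≤ lam i)
    (hlam : Tendsto lam l (𝓝 0)) (hCE : ∀ i, ContinuityEq V T (σ i) (j₁ i) (j₂ i)) {C : ℝ≥0∞}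
    (hC : C ≠ ∞) (hrate : ∀ i, rate V T (lam i) (σ i) (j₁ i) (j₂ i) ≤ C)
    {J : SignedMeasure (Ioo (0 : ℝ) T × Torus)}
    (hJ : SpaceTimeTendsto T (fun i t => firstMoment (j₂ i t)) l J) : J = 0 := by
  classical
  refine SignedMeasure.eq_zero_of_forall_integral_eq_zero _ fun f => ?_
  let ψ : ℝ → C(Torus, ℝ) := fun t =>
    if ht : t ∈ Ioo 0 T then ⟨fun x => f (⟨t, ht⟩, x), by fun_prop⟩ else 0
  have hψ (t : Ioo (0 : ℝ) T) (x : Torus) : f (t, x) = ψ t x := by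
    simp only [ψ, dif_pos t.2]
    rfl
  have hM (t : ℝ) (x : Torus) : |ψ t x| ≤ ‖f‖ := by
    by_cases ht : t ∈ Ioo 0 T
    · rw [← hψ ⟨t, ht⟩ x]
      exact f.norm_coe_le_norm _
    · simp only [ψ, dif_neg ht]
      simp
  have hlim := tendsto_lintegral_firstMoment hV hlam_nonneg hlam hCE hC hrate ψ hM
  refine tendsto_nhds_unique (hJ f) ?_
  rw [tendsto_zero_iff_enorm_tendsto_zero]
  refine tendsto_of_tendsto_of_tendsto_of_le_of_le tendsto_const_nhds hlim (fun i => zero_le)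
    fun i => ?_
  refine (enorm_integral_le_lintegral_enorm _).trans (le_of_eq ?_)
  simp_rw [hψ]
  exact lintegral_timeMeasure fun t => ‖∫ᵛ x, ψ t x ∂•(firstMoment (j₂ i t))‖ₑ

variable [l.IsCountablyGenerated]

theorem tendsto_increment_flux (hV : 0 ≤ V) (hlam_nonneg : ∀ i, 0 ≤ lam i)
    (hlam : Tendsto lam l (𝓝 0)) (hCE : ∀ i, ContinuityEq V T (σ i) (j₁ i) (j₂ i)) {C : ℝ≥0∞}
    (hC : C ≠ ∞) (hrate : ∀ i, rate V T (lam i) (σ i) (j₁ i) (j₂ i) ≤ C)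
    {b b' : C(Torus, ℝ)} (hb : HasTorusDeriv b b') {g : ℝ → ℝ}
    (hg : ∀ t ∈ Icc 0 T,
      Tendsto (fun i => ∫ x, b' x ∂(density (σ i t) : Measure Torus)) l (𝓝 (g t)))
    {s t : ℝ} (hs : s ∈ Icc 0 T) (ht : t ∈ Icc 0 T) :
    Tendsto (fun i => ∫ᵛ x, b x ∂•(flux (σ i t)) - ∫ᵛ x, b x ∂•(flux (σ i s))) l
      (𝓝 (V ^ 2 * ∫ r in s..t, g r)) := by
  simp_rw [(hCE _).weak_flux hV (hlam_nonneg _) (ne_top_of_le_ne_top hC (hrate _)) hb hs ht]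
  have hJ : Tendsto (fun i => ∫ r in s..t, ∫ᵛ x, b x ∂•(firstMoment (j₂ i r))) l (𝓝 0) := by
    rw [tendsto_zero_iff_enorm_tendsto_zero]
    exact tendsto_of_tendsto_of_tendsto_of_le_of_le tendsto_const_nhds
      (tendsto_lintegral_firstMoment hV hlam_nonneg hlam hCE hC hrate (fun _ => b)
        fun _ => b.norm_coe_le_norm) (fun i => zero_le)
      fun i => enorm_intervalIntegral_le_lintegral hs ht _
  simpa using ((tendsto_intervalIntegral_of_bound
    (fun i => (hCE i).continuousOn_integral_density b')
    (fun i t _ => abs_integral_density_le (σ i t) b') hg hs ht).const_mul (V ^ 2)).sub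
    (hJ.const_mul 2)

/-- The curves `σ^λ` converge narrowly at every time. -/
theorem exists_tendsto_of_rate_bounded [l.NeBot] (hV : 0 < V) (hT : 0 < T)
    (hlam_nonneg : ∀ i, 0 ≤ lam i)
    (hlam : Tendsto lam l (𝓝 0)) (hCE : ∀ i, ContinuityEq V T (σ i) (j₁ i) (j₂ i)) {C : ℝ≥0∞}
    (hC : C ≠ ∞) (hrate : ∀ i, rate V T (lam i) (σ i) (j₁ i) (j₂ i) ≤ C)
    {ρ : ℝ → ProbabilityMeasure Torus} {ω : SignedMeasure (Ioo (0 : ℝ) T × Torus)}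
    (hρ : ∀ t ∈ Icc (0 : ℝ) T, Tendsto (fun i => density (σ i t)) l (𝓝 (ρ t)))
    (hω : SpaceTimeTendsto T (fun i t => flux (σ i t)) l ω) {t : ℝ} (ht : t ∈ Icc 0 T) :
    ∃ τ, Tendsto (fun i => σ i t) l (𝓝 τ) := by
  have hdens (f : C(Torus, ℝ)) (s : ℝ) (hs : s ∈ Icc 0 T) :
      Tendsto (fun i => ∫ x, f x ∂(density (σ i s) : Measure Torus)) l
        (𝓝 (∫ x, f x ∂(ρ s : Measure Torus))) :=
    ((ProbabilityMeasure.continuous_integral_continuousMap f).tendsto _).comp (hρ s hs)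
  refine exists_tendsto_of_forall_smoothPhase fun φ ⟨φ', hφ⟩ => ?_
  obtain ⟨a, a', b, b', ha, hb, hφab⟩ := hφ.exists_decomposition hV
  suffices h : ∃ w, Tendsto (fun i => ∫ᵛ x, b x ∂•(flux (σ i t))) l (𝓝 w) by
    obtain ⟨w, hw⟩ := h
    refine ⟨_, ((hdens a t ht).add hw).congr fun i => ?_⟩
    rw [integral_eq_density_add_flux _ hφab]
  refine exists_tendsto_of_increments hT (W := fun i t => ∫ᵛ x, b x ∂•(flux (σ i t)))
    (fun i => (hCE i).continuousOn_integral_flux b)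
    (fun i t _ => abs_integral_flux_le hV.le (σ i t) b)
    (fun s hs t ht => tendsto_increment_flux hV.le hlam_nonneg hlam hCE hC hrate hb
      (hdens b') hs ht)
    (c := ∫ᵛ z, b z.2 ∂•ω) ?_ ht
  refine (hω ((BoundedContinuousFunction.mkOfCompact b).compContinuous
    ContinuousMap.snd)).congr fun i => ?_
  rw [intervalIntegral.integral_of_le hT.le, integral_Ioc_eq_integral_Ioo]
  exact integral_timeMeasure fun t => ∫ᵛ x, b x ∂•(flux (σ i t))

end HyperbolicLimit

end Kac

namespace Kac

theorem integrableFamily_zero {X : Type*} [MeasurableSpace X] (T : ℝ) :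
    IntegrableFamily T fun _ => (0 : SignedMeasure X) :=
  ⟨fun _ _ => measurable_const, by simp [SignedMeasure.totalVariation_zero]⟩

section LimitCurve

variable {V T : ℝ}

/-- Weak solutions of the wave system, with `ρ` and `ω` the moments of a curve on phase space. -/
structure WeakWave (V T : ℝ) (σ : ℝ → ProbabilityMeasure (Phase V)) : Prop where
  density : ∀ a a' : C(Torus, ℝ), HasTorusDeriv a a' → ∀ s ∈ Icc 0 T, ∀ t ∈ Icc 0 T,
    ∫ x, a x ∂(density (σ t) : Measure Torus) - ∫ x, a x ∂(density (σ s) : Measure Torus) =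
      ∫ r in s..t, ∫ᵛ x, a' x ∂•(flux (σ r))
  flux : ∀ b b' : C(Torus, ℝ), HasTorusDeriv b b' → ∀ s ∈ Icc 0 T, ∀ t ∈ Icc 0 T,
    ∫ᵛ x, b x ∂•(flux (σ t)) - ∫ᵛ x, b x ∂•(flux (σ s)) =
      V ^ 2 * ∫ r in s..t, ∫ x, b' x ∂(Kac.density (σ r) : Measure Torus)

theorem WeakWave.continuousOn (hV : 0 < V) {σ : ℝ → ProbabilityMeasure (Phase V)}
    (h : WeakWave V T σ) : ContinuousOn σ (Icc 0 T) := by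
  intro t ht
  refine tendsto_of_forall_smoothPhase fun φ ⟨φ', hφ⟩ => ?_
  obtain ⟨a, a', b, b', ha, hb, hab⟩ := hφ.exists_decomposition hV
  simp_rw [integral_eq_density_add_flux _ hab]
  refine Tendsto.add ?_ ?_
  · exact continuousOn_of_integral_eq (fun r _ => abs_integral_flux_le hV.le (σ r) a')
      (h.density a a' ha) t ht
  · refine continuousOn_of_integral_eq
      (g := fun r => V ^ 2 * ∫ x, b' x ∂(Kac.density (σ r) : Measure Torus)) (M := V ^ 2 * ‖b'‖)
      (fun r _ => ?_) (fun s hs t ht => ?_) t ht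
    · rw [abs_mul, abs_of_nonneg (sq_nonneg V)]
      exact mul_le_mul_of_nonneg_left (abs_integral_density_le (σ r) b') (sq_nonneg V)
    · rw [intervalIntegral.integral_const_mul]
      exact h.flux b b' hb s hs t ht

theorem WeakWave.momentumEq (hV : 0 < V) {σ : ℝ → ProbabilityMeasure (Phase V)}
    (h : WeakWave V T σ) {ρ : ℝ → ProbabilityMeasure Torus}
    (hρ : ∀ t ∈ Icc 0 T, ρ t = Kac.density (σ t)) :
    MomentumEq V T ρ (fun t => Kac.flux (σ t)) fun _ => 0 where
  continuousOn_density := (continuous_density.comp_continuousOn (h.continuousOn hV)).congr hρ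
  continuousOn_flux f :=
    (continuous_integral_flux f).comp_continuousOn ((h.continuousOn hV).mono Ioo_subset_Icc_self)
  integrable := integrableFamily_zero T
  weak_density a a' ha s t hs hst ht := by
    have hs' : s ∈ Icc 0 T := ⟨hs, hst.trans ht⟩
    have ht' : t ∈ Icc 0 T := ⟨hs.trans hst, ht⟩
    rw [hρ s hs', hρ t ht', h.density a a' ha s hs' t ht']
  weak_flux b b' hb s t hs hst ht := by
    have hs' : s ∈ Icc 0 T := ⟨hs, hst.trans ht⟩
    have ht' : t ∈ Icc 0 T := ⟨hs.trans hst, ht⟩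
    rw [h.flux b b' hb s hs' t ht']
    simp only [VectorMeasure.integral_zero_vectorMeasure, intervalIntegral.integral_zero, mul_zero,
      sub_zero]
    congr 1
    refine intervalIntegral.integral_congr fun r hr => ?_
    simp only [hρ r (ordConnected_Icc.uIcc_subset hs' ht' hr)]

end LimitCurve

section HyperbolicLimit

variable {ι : Type*} {l : Filter ι} [l.IsCountablyGenerated] {V T : ℝ} {lam : ι → ℝ}
  {σ : ι → ℝ → ProbabilityMeasure (Phase V)} {j₁ j₂ : ι → ℝ → SignedMeasure (Phase V)}

/-- A pointwise narrow limit of curves of bounded rate solves the wave system as `lam → 0`. -/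
theorem weakWave_of_tendsto [l.NeBot] (hV : 0 ≤ V) (hlam_nonneg : ∀ i, 0 ≤ lam i)
    (hlam : Tendsto lam l (𝓝 0)) (hCE : ∀ i, ContinuityEq V T (σ i) (j₁ i) (j₂ i)) {C : ℝ≥0∞}
    (hC : C ≠ ∞) (hrate : ∀ i, rate V T (lam i) (σ i) (j₁ i) (j₂ i) ≤ C)
    {τ : ℝ → ProbabilityMeasure (Phase V)}
    (hτ : ∀ t ∈ Icc 0 T, Tendsto (fun i => σ i t) l (𝓝 (τ t))) : WeakWave V T τ := by
  have hfin (i : ι) : rate V T (lam i) (σ i) (j₁ i) (j₂ i) ≠ ∞ := ne_top_of_le_ne_top hC (hrate i)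
  have hdens (f : C(Torus, ℝ)) (s : ℝ) (hs : s ∈ Icc 0 T) :=
    ((continuous_integral_density (V := V) f).tendsto _).comp (hτ s hs)
  have hflux (f : C(Torus, ℝ)) (s : ℝ) (hs : s ∈ Icc 0 T) :=
    ((continuous_integral_flux (V := V) f).tendsto _).comp (hτ s hs)
  constructor
  · intro a a' ha s hs t ht
    refine tendsto_nhds_unique ((hdens a t ht).sub (hdens a s hs)) ?_
    simp_rw [Function.comp_apply, (hCE _).weak_density (hfin _) ha hs ht]
    exact tendsto_intervalIntegral_of_bound (fun i => (hCE i).continuousOn_integral_flux a')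
      (fun i t _ => abs_integral_flux_le hV (σ i t) a') (hflux a') hs ht
  · intro b b' hb s hs t ht
    refine tendsto_nhds_unique ((hflux b t ht).sub (hflux b s hs)) ?_
    simp_rw [Function.comp_apply]
    exact tendsto_increment_flux hV hlam_nonneg hlam hCE hC hrate hb (hdens b') hs ht

theorem tendsto_integral_flux (hV : 0 ≤ V) (hσ : ∀ i, ContinuousOn (σ i) (Icc 0 T))
    {τ : ℝ → ProbabilityMeasure (Phase V)}
    (hτ : ∀ t ∈ Icc 0 T, Tendsto (fun i => σ i t) l (𝓝 (τ t)))
    (f : (Ioo (0 : ℝ) T × Torus) →ᵇ ℝ) :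
    Tendsto (fun i => ∫ t : Ioo (0 : ℝ) T, ∫ᵛ x, f (t, x) ∂•(flux (σ i t)) ∂(timeMeasure T)) l
      (𝓝 (∫ t : Ioo (0 : ℝ) T, ∫ᵛ x, f (t, x) ∂•(flux (τ t)) ∂(timeMeasure T))) := by
  let g (t : Ioo (0 : ℝ) T) : C(Torus, ℝ) := ⟨fun x => f (t, x), by fun_prop⟩
  have hg (t : Ioo (0 : ℝ) T) : ‖g t‖ ≤ ‖f‖ :=
    (ContinuousMap.norm_le _ (norm_nonneg _)).2 fun x => f.norm_coe_le_norm _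
  refine tendsto_integral_filter_of_dominated_convergence (fun _ => V * ‖f‖)
    (Eventually.of_forall fun i =>
      (integrable_integral_flux ((hσ i).mono Ioo_subset_Icc_self) f).aestronglyMeasurable)
    (Eventually.of_forall fun i => Eventually.of_forall fun t => ?_) (integrable_const _)
    (Eventually.of_forall fun t => ?_)
  · exact (abs_integral_flux_le hV (σ i t) (g t)).trans (mul_le_mul_of_nonneg_left (hg t) hV)
  · exact ((continuous_integral_flux (g t)).tendsto _).comp (hτ t (Ioo_subset_Icc_self t.2))

end HyperbolicLimit

theorem disintegrates_zero (T : ℝ) : Disintegrates T 0 fun _ => 0 :=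
  ⟨integrableFamily_zero T, fun _ _ => by simp⟩

end Kac

theorem theorem4p11 {ι : Type*} (l : Filter ι) [l.NeBot] [l.IsCountablyGenerated]
    (V T : ℝ) (hV : 0 < V) (hT : 0 < T)
    (lam : ι → ℝ) (hlam_pos : ∀ i, 0 < lam i) (hlam : Tendsto lam l (𝓝 0))
    (σ : ι → ℝ → ProbabilityMeasure (Kac.Phase V))
    (j₁ j₂ : ι → ℝ → SignedMeasure (Kac.Phase V))
    (hCE : ∀ i, Kac.ContinuityEq V T (σ i) (j₁ i) (j₂ i))
    (C : ℝ≥0)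
    (hbound : ∀ i,
      InformationTheory.klDiv (σ i 0 : Measure (Kac.Phase V)) (Kac.stationary V) +
        Kac.rate V T (lam i) (σ i) (j₁ i) (j₂ i) ≤ C)
    (ρbar : ℝ → ProbabilityMeasure Kac.Torus)
    (ωbar Jbar : SignedMeasure (Ioo (0 : ℝ) T × Kac.Torus))
    (hρ : ∀ t ∈ Icc (0 : ℝ) T, Tendsto (fun i => Kac.density (σ i t)) l (𝓝 (ρbar t)))
    (hω : Kac.SpaceTimeTendsto T (fun i t => Kac.flux (σ i t)) l ωbar)
    (hJ : Kac.SpaceTimeTendsto T (fun i t => Kac.firstMoment (j₂ i t)) l Jbar) :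
    ∃ ω J : ℝ → SignedMeasure Kac.Torus,
      Kac.Disintegrates T ωbar ω ∧ Kac.Disintegrates T Jbar J ∧
      Kac.limitFunctional V T ρbar ω J ≤
        liminf (fun i => Kac.rate V T (lam i) (σ i) (j₁ i) (j₂ i)) l ∧
      Jbar = 0 ∧ Kac.NarrowContinuousOn ω (Icc 0 T) ∧
      Kac.MomentumEq V T ρbar ω (fun _ => 0) := by
  have hlam_nonneg (i : ι) : 0 ≤ lam i := (hlam_pos i).le
  have hrate (i : ι) : Kac.rate V T (lam i) (σ i) (j₁ i) (j₂ i) ≤ (C : ℝ≥0∞) :=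
    le_add_self.trans (hbound i)
  have hlim (t : ℝ) : ∃ τ, t ∈ Icc 0 T → Tendsto (fun i => σ i t) l (𝓝 τ) := by
    by_cases ht : t ∈ Icc 0 T
    · obtain ⟨τ, hτ⟩ := Kac.exists_tendsto_of_rate_bounded hV hT hlam_nonneg hlam hCE
        ENNReal.coe_ne_top hrate hρ hω ht
      exact ⟨τ, fun _ => hτ⟩
    · obtain ⟨i⟩ := l.nonempty_of_neBot
      exact ⟨σ i t, fun h => absurd h ht⟩
  choose τ hτ using hlim
  have hwave := Kac.weakWave_of_tendsto hV.le hlam_nonneg hlam hCE ENNReal.coe_ne_top hrate hτ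
  have hcont := hwave.continuousOn hV
  have hdens (t : ℝ) (ht : t ∈ Icc 0 T) : ρbar t = Kac.density (τ t) :=
    tendsto_nhds_unique (hρ t ht) ((Kac.continuous_density.tendsto _).comp (hτ t ht))
  have hME := hwave.momentumEq hV hdens
  have hJ0 : Jbar = 0 := Kac.eq_zero_of_spaceTimeTendsto_firstMoment hV.le hlam_nonneg hlam hCE
    ENNReal.coe_ne_top hrate hJ
  have hflux : Kac.NarrowContinuousOn (fun t => Kac.flux (τ t)) (Icc 0 T) :=
    fun f => (Kac.continuous_integral_flux f).comp_continuousOn hcont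
  refine ⟨fun t => Kac.flux (τ t), fun _ => 0,
    Kac.disintegrates_flux (hcont.mono Ioo_subset_Icc_self) fun f => ?_,
    hJ0 ▸ Kac.disintegrates_zero T, ?_, hJ0, hflux, hME⟩
  · exact tendsto_nhds_unique (hω f)
      (Kac.tendsto_integral_flux hV.le (fun i => (hCE i).continuousOn) hτ f)
  · rw [Kac.limitFunctional, if_pos ⟨hflux, hME, Eventually.of_forall fun _ => rfl⟩]
    exact zero_le
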